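/- Let $n,d\ge 1$ be integers and write points of $\mathbb{R}^{n+d}=\mathbb{R}^n\times\mathbb{R}^d$ as $y=(z,x)$. Let $C\subset\mathbb{R}^{n+d}$ be a convex body (a compact convex set with nonempty interior), let $S=C\cap(\mathbb{Z}^n\times\mathbb{R}^d)$, and let $K=\{z\in\mathbb{R}^n:\ (z,x)\in C\text{ for some }x\in\mathbb{R}^d\}$ be the projection of $C$ to $\mathbb{R}^n$. For $A\subseteq\mathbb{Z}^n\times\mathbb{R}^d$ whose fibers $\{x\in\mathbb{R}^d:(z,x)\in A\}$, $z\in\mathbb{Z}^n$, are Lebesgue measurable, define the mixed-integer volume $$\mathcal{H}_d(A)=\sum_{z\in\mathbb{Z}^n}\operatorname{vol}_d\bigl(\{x\in\mathbb{R}^d:\ (z,x)\in A\}\bigr).$$ A closed halfspace is a set $\{y\in\mathbb{R}^{n+d}: a^{\mathsf T}y\ge c\}$ with $a\in\mathbb{R}^{n+d}\setminus\{0\}$ and $c\in\mathbb{R}$. For $y\in S$ let $$h_S(y)=\inf\{\mathcal{H}_d(S\cap H):\ H\subset\mathbb{R}^{n+d}\text{ is a closed halfspace with }y\in H\},$$ and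 let $\mathcal{C}(S)=\{y\in S:\ h_S(y)\ge h_S(y')\text{ for all }y'\in S\}$ be the set of centerpoints of $S$. Assume that there are $z_0\in\mathbb{R}^n$ and $k\ge 3e(n+d)$ such that $z_0+ku\in K$ for every $u\in\mathbb{R}^n$ with $\|u\|_\infty\le 1$. Then $\mathcal{C}(S)\ne\emptyset$, and every $\hat y\in\mathcal{C}(S)$ satisfies $$h_S(\hat y)\ \ge\ \frac{1}{2e}\,\mathcal{H}_d(S)\ \ge\ \frac{1}{2^n e}\,\mathcal{H}_d(S).$$ In particular, Oertel's conjecture holds for $C$: there is $y\in S$ such that $\mathcal{H}_d(S\cap H)\ge\frac{1}{2^n e}\,\mathcal{H}_d(S)$ for every closed halfspace $H$ containing $y$. -/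

import Mathlib

open MeasureTheory
open scoped ENNReal

namespace MixedInteger

/-- The space `ℝ^{n+d} = ℝ^n × ℝ^d`, whose points are written `(z, x)`. -/
abbrev Space (n d : ℕ) : Type := (Fin n → ℝ) × (Fin d → ℝ)

/-- The mixed-integer lattice `Λ = ℤ^n × ℝ^d`. -/
def lattice (n d : ℕ) : Set (Space n d) :=
  {y | ∀ i, ∃ m : ℤ, (m : ℝ) = y.1 i}

/-- The mixed-integer points `S = C ∩ Λ` of a set `C`. -/
def points {n d : ℕ} (C : Set (Space n d)) : Set (Space n d) :=
  C ∩ lattice n d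

/-- The `z`-fiber `A_z = {x ∈ ℝ^d : (z, x) ∈ A}`. -/
def fiber {n d : ℕ} (A : Set (Space n d)) (z : Fin n → ℝ) : Set (Fin d → ℝ) :=
  {x | (z, x) ∈ A}

/-- The mixed-integer volume `H_d(A) = ∑_{z ∈ ℤ^n} vol_d(A_z)`, with values in `[0, ∞]`. -/
noncomputable def mixedVolume {n d : ℕ} (A : Set (Space n d)) : ℝ≥0∞ :=
  ∑' z : Fin n → ℤ, volume (fiber A (fun i => (z i : ℝ)))

/-- Closed halfspaces `{y : aᵀ y ≥ c}` with `a ≠ 0`, where `a = (a.1, a.2) ∈ ℝ^n × ℝ^d`. -/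
def IsClosedHalfspace {n d : ℕ} (H : Set (Space n d)) : Prop :=
  ∃ (a : Space n d) (c : ℝ), a ≠ 0 ∧
    H = {y | c ≤ ∑ i, a.1 i * y.1 i + ∑ j, a.2 j * y.2 j}

/-- The halfspace depth `h_S(y)`: the infimum of `H_d(S ∩ H)` over the closed halfspaces `H`
containing `y`. -/
noncomputable def depth {n d : ℕ} (S : Set (Space n d)) (y : Space n d) : ℝ≥0∞ :=
  sInf {v | ∃ H : Set (Space n d), IsClosedHalfspace H ∧ y ∈ H ∧ v = mixedVolume (S ∩ H)}

/-- The centerpoints of `S`: the maximizers over `y ∈ S` of the halfspace depth `h_S(y)`. -/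
def centerpoints {n d : ℕ} (S : Set (Space n d)) : Set (Space n d) :=
  {y | y ∈ S ∧ ∀ y' ∈ S, depth S y' ≤ depth S y}

end MixedInteger

/-!
The point that works is a lattice point next to the centroid `g` of `C`.

Grünbaum's inequality says that a halfspace containing `g` contains at least the fraction `1 / e` of
the volume of `C`. It is derived here from the Prékopa–Leindler inequality: the volume `V t` of
`C ∩ {t ≤ φ}` is a log-concave function of `t`, so it lies below an exponential touching it at
`t = φ g`, and integrating the exponent over `C` against the tail bound that this gives yields
`log (V₀ / V (φ g)) ≤ 1`, where `V₀` is the volume of `C`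
(`measure_le_exp_mul_measure_inter_halfspace`).

Volume and mixed-integer volume are compared by rounding: a homothety of ratio `1 - l` moves a fiber
of `C` towards a point `r` of `C`, and when `r` is free to vary over a cube of half-width `κ` with
`l * κ ≥ 1 / 2`, it can be chosen such that an arbitrary fiber is moved onto an integral one, or the
other way round. This costs a factor `(1 - l) ^ (n + d)` in either direction
(`volume_le_mixedVolume`, `mixedVolume_le_volume`).

For a halfspace `{c ≤ φ}` the points `r` must in addition have large `φ`-values, and this may fail
when `C` is tilted over the cube. The remedy is a dichotomy (`exists_high_or_low_section`). Let
`top` maximize `φ` on `C`. If the points of `C` over every point of the cube, averaged with `top`,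
reach a given level `σ`, rounding bounds the mixed-integer volume of `C ∩ {c ≤ φ}` from below.
Otherwise all points of `C` over some point of the cube lie so low that averaging the points over the cube
with one of them stays below `σ`; then rounding bounds the mixed-integer volume of the complementary
part `C ∩ {φ < c}` from above. With weight `1 / 4` in the average both bounds leave the fraction
`1 / (2e)` (`exists_deep_point`).

Centerpoints exist because the depth is upper semicontinuous on the compact set of mixed-integer
points, by continuity from above of the mixed-integer volume.
-/

open scoped Pointwise

namespace MixedInteger

/-! ### The Prékopa–Leindler inequality -/

/-- The one-dimensional Brunn–Minkowski inequality for compact sets: `K + L` contains translates of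
`K` and `L` that share a single point. -/
theorem volume_add_le_of_isCompact {K L : Set ℝ} (hK : IsCompact K) (hL : IsCompact L)
    (hK' : K.Nonempty) (hL' : L.Nonempty) : volume K + volume L ≤ volume (K + L) := by
  obtain ⟨p, hp, hpm⟩ := hK.exists_isGreatest hK'
  obtain ⟨q, hq, hqm⟩ := hL.exists_isLeast hL'
  have h1 : volume ((q + ·) '' K) = volume K := by
    simp
  have h2 : volume ((p + ·) '' L) = volume L := by
    simp
  have hsub : ((q + ·) '' K) ∪ ((p + ·) '' L) ⊆ K + L := by
    rintro _ (⟨x, hx, rfl⟩ | ⟨x, hx, rfl⟩)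
    · exact ⟨x, hx, q, hq, add_comm _ _⟩
    · exact ⟨p, hp, x, hx, rfl⟩
  have hdisj : AEDisjoint volume ((q + ·) '' K) ((p + ·) '' L) := by
    refine measure_mono_null (t := {p + q}) ?_ (by simp)
    rintro _ ⟨⟨x, hx, rfl⟩, ⟨y, hy, hxy⟩⟩
    have := hpm hx
    have := hqm hy
    simp only [Set.mem_singleton_iff] at *
    linarith
  calc volume K + volume L = volume (((q + ·) '' K) ∪ ((p + ·) '' L)) := by
        rw [measure_union₀ _ hdisj, h1, h2]
        exact (hL.image (by fun_prop)).measurableSet.nullMeasurableSet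
    _ ≤ _ := measure_mono hsub

/-- The one-dimensional Brunn–Minkowski inequality; `A + B` need not be measurable. -/
theorem volume_add_le {A B : Set ℝ} (hA : MeasurableSet A) (hB : MeasurableSet B)
    (hA' : A.Nonempty) (hB' : B.Nonempty) : volume A + volume B ≤ volume (A + B) := by
  obtain ⟨p, hp⟩ := hA'
  obtain ⟨q, hq⟩ := hB'
  have key : ∀ K, K ⊆ A ∧ IsCompact K → ∀ L, L ⊆ B ∧ IsCompact L →
      volume K + volume L ≤ volume (A + B) := by
    intro K ⟨hKA, hK⟩ L ⟨hLB, hL⟩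
    calc volume K + volume L ≤ volume (insert p K) + volume (insert q L) := by
          gcongr <;> exact Set.subset_insert _ _
      _ ≤ volume (insert p K + insert q L) :=
          volume_add_le_of_isCompact (hK.insert p) (hL.insert q) (Set.insert_nonempty _ _)
            (Set.insert_nonempty _ _)
      _ ≤ volume (A + B) := by
          gcongr
          · exact Set.insert_subset hp hKA
          · exact Set.insert_subset hq hLB
  have := ENNReal.biSup_add_biSup_le' (f := fun K => volume K) (g := fun K => volume K)
    ⟨∅, by simp⟩ ⟨∅, by simp⟩ key
  rw [hA.measure_eq_iSup_isCompact, hB.measure_eq_iSup_isCompact]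
  simpa only [iSup_and] using this

theorem volume_smul_add_smul_le {A B : Set ℝ} (hA : MeasurableSet A) (hB : MeasurableSet B)
    (hA' : A.Nonempty) (hB' : B.Nonempty) {a b : ℝ} (ha : 0 < a) (hb : 0 < b) :
    ENNReal.ofReal a * volume A + ENNReal.ofReal b * volume B ≤ volume (a • A + b • B) := by
  have := volume_add_le (hA.const_smul₀ a) (hB.const_smul₀ b) hA'.smul_set hB'.smul_set
  simpa [Measure.addHaar_smul, abs_of_pos ha, abs_of_pos hb] using this

theorem ennreal_geom_mean_le {a b : ℝ} (ha : 0 < a) (hb : 0 < b) (hab : a + b = 1)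
    (u v : ℝ≥0∞) : u ^ a * v ^ b ≤ ENNReal.ofReal a * u + ENNReal.ofReal b * v := by
  have hpq : (a⁻¹).HolderConjugate b⁻¹ := by
    rw [Real.holderConjugate_iff]
    refine ⟨(one_lt_inv₀ ha).2 (by linarith), by simpa using hab⟩
  have := ENNReal.young_inequality (u ^ a) (v ^ b) hpq
  rw [← ENNReal.rpow_mul, ← ENNReal.rpow_mul, mul_inv_cancel₀ ha.ne', mul_inv_cancel₀ hb.ne',
    ENNReal.rpow_one, ENNReal.rpow_one, ENNReal.ofReal_inv_of_pos ha, ENNReal.ofReal_inv_of_pos hb,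
    ENNReal.div_eq_inv_mul, ENNReal.div_eq_inv_mul, inv_inv, inv_inv] at this
  exact this

theorem lintegral_eq_setLIntegral_meas_lt_of_le_one {f : ℝ → ℝ≥0∞} (hf : Measurable f)
    (hf1 : ∀ x, f x ≤ 1) :
    ∫⁻ x, f x = ∫⁻ t in Set.Ioo (0 : ℝ) 1, volume {x | ENNReal.ofReal t < f x} := by
  have hfin : ∀ x, f x ≠ ∞ := fun x => ((hf1 x).trans_lt ENNReal.one_lt_top).ne
  have h := lintegral_eq_lintegral_meas_lt (volume : Measure ℝ) (f := fun x => (f x).toReal)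
    (Filter.Eventually.of_forall fun x => ENNReal.toReal_nonneg) hf.ennreal_toReal.aemeasurable
  simp only [ENNReal.ofReal_toReal (hfin _)] at h
  rw [h, ← lintegral_indicator measurableSet_Ioi, ← lintegral_indicator measurableSet_Ioo]
  congr 1 with t
  by_cases ht : t ∈ Set.Ioo (0 : ℝ) 1
  · rw [Set.indicator_of_mem ht, Set.indicator_of_mem (Set.Ioo_subset_Ioi_self ht)]
    congr 1
    ext x
    simp only [Set.mem_ofPred_eq]
    rw [ENNReal.ofReal_lt_iff_lt_toReal ht.1.le (hfin x)]
  · rw [Set.indicator_of_notMem ht, Set.indicator_apply_eq_zero]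
    intro ht0
    have ht1 : 1 ≤ t := not_lt.1 fun hlt => ht ⟨ht0, hlt⟩
    have : {x | t < (f x).toReal} = ∅ := by
      ext x
      have h1 : (f x).toReal ≤ 1 :=
        ENNReal.toReal_le_of_le_ofReal zero_le_one (by simpa using hf1 x)
      simp only [Set.mem_ofPred_eq, Set.mem_empty_iff_false, iff_false, not_lt]
      linarith
    rw [this, measure_empty]

/-- The one-dimensional Prékopa–Leindler inequality for functions of supremum `1`, in a form with
arithmetic means: the superlevel sets of `f` and `g` at a level below `1` are nonempty, so that the
Brunn–Minkowski inequality applies to them. -/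
theorem lintegral_add_le_of_iSup_eq_one {a b : ℝ} (ha : 0 < a) (hb : 0 < b) (hab : a + b = 1)
    {f g h : ℝ → ℝ≥0∞} (hf : Measurable f) (hg : Measurable g) (hh : Measurable h)
    (hf1 : ⨆ x, f x = 1) (hg1 : ⨆ x, g x = 1)
    (hfgh : ∀ x y, f x ^ a * g y ^ b ≤ h (a * x + b * y)) :
    ENNReal.ofReal a * (∫⁻ x, f x) + ENNReal.ofReal b * ∫⁻ x, g x ≤ ∫⁻ x, h x := by
  have hf1' : ∀ x, f x ≤ 1 := fun x => hf1 ▸ le_iSup f x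
  have hg1' : ∀ x, g x ≤ 1 := fun x => hg1 ▸ le_iSup g x
  have hmono : Monotone fun t : ℝ => ENNReal.ofReal t := fun _ _ h => ENNReal.ofReal_le_ofReal h
  have meas : ∀ φ : ℝ → ℝ≥0∞, Measurable fun t : ℝ => volume {x | ENNReal.ofReal t < φ x} := by
    intro φ
    refine Antitone.measurable fun s t hst => measure_mono fun x hx => ?_
    exact (hmono hst).trans_lt hx
  calc ENNReal.ofReal a * (∫⁻ x, f x) + ENNReal.ofReal b * ∫⁻ x, g x
      = ∫⁻ t in Set.Ioo (0 : ℝ) 1, (ENNReal.ofReal a * volume {x | ENNReal.ofReal t < f x}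
          + ENNReal.ofReal b * volume {x | ENNReal.ofReal t < g x}) := by
        rw [lintegral_eq_setLIntegral_meas_lt_of_le_one hf hf1',
          lintegral_eq_setLIntegral_meas_lt_of_le_one hg hg1',
          lintegral_add_left ((meas f).const_mul _), lintegral_const_mul _ (meas f),
          lintegral_const_mul _ (meas g)]
    _ ≤ ∫⁻ t in Set.Ioo (0 : ℝ) 1, volume {x | ENNReal.ofReal t < min (h x) 1} := by
        refine setLIntegral_mono (meas _) fun t ht => ?_
        have ht1 : ENNReal.ofReal t < 1 := ENNReal.ofReal_lt_one.2 ht.2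
        have ht0 : ENNReal.ofReal t ≠ 0 := by simpa using ht.1
        obtain ⟨x₀, hx₀⟩ := lt_iSup_iff.1 (hf1.symm ▸ ht1)
        obtain ⟨y₀, hy₀⟩ := lt_iSup_iff.1 (hg1.symm ▸ ht1)
        refine (volume_smul_add_smul_le (A := {x | ENNReal.ofReal t < f x})
          (B := {x | ENNReal.ofReal t < g x}) (hf measurableSet_Ioi) (hg measurableSet_Ioi)
          ⟨x₀, hx₀⟩ ⟨y₀, hy₀⟩ ha hb).trans
          (measure_mono ?_)
        rintro _ ⟨_, ⟨x, hx, rfl⟩, _, ⟨y, hy, rfl⟩, rfl⟩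
        -- The truncation `min (h x) 1` loses nothing, as only levels below `1` occur.
        refine lt_min ?_ ht1
        refine lt_of_lt_of_le ?_ (hfgh x y)
        calc ENNReal.ofReal t = ENNReal.ofReal t ^ a * ENNReal.ofReal t ^ b := by
              rw [← ENNReal.rpow_add _ _ ht0 ENNReal.ofReal_ne_top, hab, ENNReal.rpow_one]
          _ < f x ^ a * g y ^ b :=
              ENNReal.mul_lt_mul (ENNReal.rpow_lt_rpow hx ha) (ENNReal.rpow_lt_rpow hy hb)
    _ = ∫⁻ x, min (h x) 1 :=
        (lintegral_eq_setLIntegral_meas_lt_of_le_one (hh.min measurable_const)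
          fun x => min_le_right _ _).symm
    _ ≤ ∫⁻ x, h x := lintegral_mono fun x => min_le_left _ _

/-- The Prékopa–Leindler inequality for a measure `μ` on a real vector space. -/
def PrekopaLeindler {E : Type*} [AddCommGroup E] [Module ℝ E] [MeasurableSpace E]
    (μ : Measure E) : Prop :=
  ∀ ⦃a b : ℝ⦄, 0 < a → 0 < b → a + b = 1 → ∀ ⦃f g h : E → ℝ≥0∞⦄,
    Measurable f → Measurable g → Measurable h →
    (∀ x y, f x ^ a * g y ^ b ≤ h (a • x + b • y)) →
    (∫⁻ x, f x ∂μ) ^ a * (∫⁻ x, g x ∂μ) ^ b ≤ ∫⁻ x, h x ∂μ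

theorem lintegral_rpow_mul_le_of_bounded {a b : ℝ} (ha : 0 < a) (hb : 0 < b) (hab : a + b = 1)
    {f g h : ℝ → ℝ≥0∞} (hf : Measurable f) (hg : Measurable g) (hh : Measurable h)
    (hfb : ⨆ x, f x ≠ ∞) (hgb : ⨆ x, g x ≠ ∞)
    (hfgh : ∀ x y, f x ^ a * g y ^ b ≤ h (a * x + b * y)) :
    (∫⁻ x, f x) ^ a * (∫⁻ x, g x) ^ b ≤ ∫⁻ x, h x := by
  set M := ⨆ x, f x with hM
  set N := ⨆ x, g x with hN
  rcases eq_or_ne M 0 with hM0 | hM0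
  · have : ∀ x, f x = 0 := by simpa [hM] using hM0
    simp [this, ENNReal.zero_rpow_of_pos ha]
  rcases eq_or_ne N 0 with hN0 | hN0
  · have : ∀ x, g x = 0 := by simpa [hN] using hN0
    simp [this, ENNReal.zero_rpow_of_pos hb]
  have hMa : M ^ a ≠ 0 := by simp [ENNReal.rpow_eq_zero_iff, hM0, hfb]
  have hMa' : M ^ a ≠ ∞ := by simp [ENNReal.rpow_eq_top_iff, hM0, hfb]
  have hNb : N ^ b ≠ 0 := by simp [ENNReal.rpow_eq_zero_iff, hN0, hgb]
  have hNb' : N ^ b ≠ ∞ := by simp [ENNReal.rpow_eq_top_iff, hN0, hgb]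
  have key := lintegral_add_le_of_iSup_eq_one ha hb hab (f := fun x => M⁻¹ * f x)
    (g := fun x => N⁻¹ * g x) (h := fun x => (M ^ a * N ^ b)⁻¹ * h x)
    (hf.const_mul _) (hg.const_mul _) (hh.const_mul _)
    (by rw [← ENNReal.mul_iSup, ← hM, ENNReal.inv_mul_cancel hM0 hfb])
    (by rw [← ENNReal.mul_iSup, ← hN, ENNReal.inv_mul_cancel hN0 hgb]) (by
      intro x y
      rw [ENNReal.mul_rpow_of_nonneg _ _ ha.le, ENNReal.mul_rpow_of_nonneg _ _ hb.le,
        ENNReal.inv_rpow, ENNReal.inv_rpow, ENNReal.mul_inv (Or.inl hMa) (Or.inl hMa'),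
        mul_mul_mul_comm]
      gcongr
      exact hfgh x y)
  have key2 := (ennreal_geom_mean_le ha hb hab _ _).trans key
  rw [lintegral_const_mul _ hf, lintegral_const_mul _ hg, lintegral_const_mul _ hh,
    ENNReal.mul_rpow_of_nonneg _ _ ha.le, ENNReal.mul_rpow_of_nonneg _ _ hb.le,
    ENNReal.inv_rpow, ENNReal.inv_rpow, mul_mul_mul_comm,
    ← ENNReal.mul_inv (Or.inl hMa) (Or.inl hMa')] at key2
  exact (ENNReal.mul_le_mul_iff_right (ENNReal.inv_ne_zero.2 (ENNReal.mul_ne_top hMa' hNb'))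
    (ENNReal.inv_ne_top.2 (mul_ne_zero hMa hNb))).1 key2

theorem iSup_min_natCast (u : ℝ≥0∞) : ⨆ m : ℕ, min u m = u := by
  rw [← inf_iSup_eq, ENNReal.iSup_natCast, inf_top_eq]

theorem prekopaLeindler_real : PrekopaLeindler (volume : Measure ℝ) := by
  intro a b ha hb hab f g h hf hg hh hfgh
  -- Truncation at natural numbers reduces to bounded functions.
  have trunc : ∀ φ : ℝ → ℝ≥0∞, Measurable φ → ∀ c : ℝ, 0 < c →
      (∫⁻ x, φ x) ^ c = ⨆ m : ℕ, (∫⁻ x, min (φ x) m) ^ c := by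
    intro φ hφ c hc
    rw [show (∫⁻ x, φ x) = ⨆ m : ℕ, ∫⁻ x, min (φ x) m by
      rw [← lintegral_iSup (fun m => hφ.min measurable_const)]
      · simp_rw [iSup_min_natCast]
      · intro m m' hm x
        exact min_le_min_left _ (Nat.cast_le.2 hm)]
    exact (ENNReal.orderIsoRpow c hc).map_iSup _
  have hb' : ∀ φ : ℝ → ℝ≥0∞, ∀ m : ℕ, ⨆ x, min (φ x) (m : ℝ≥0∞) ≠ ∞ := fun φ m =>
    ((iSup_le fun x => min_le_right _ _).trans_lt (ENNReal.natCast_lt_top m)).ne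
  rw [trunc f hf a ha, trunc g hg b hb]
  simp only [ENNReal.iSup_mul, ENNReal.mul_iSup, iSup_le_iff]
  intro m m'
  refine lintegral_rpow_mul_le_of_bounded ha hb hab (hf.min measurable_const)
    (hg.min measurable_const) hh (hb' f _) (hb' g _) fun x y => le_trans ?_ (hfgh x y)
  gcongr <;> exact min_le_left _ _

/-- The Prékopa–Leindler inequality passes to product measures: apply it to the functions on the
fibers, then to their integrals. -/
theorem PrekopaLeindler.prod {E F : Type*} [AddCommGroup E] [Module ℝ E] [MeasurableSpace E]
    [AddCommGroup F] [Module ℝ F] [MeasurableSpace F] {μ : Measure E} {ν : Measure F} [SFinite ν]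
    (hμ : PrekopaLeindler μ) (hν : PrekopaLeindler ν) : PrekopaLeindler (μ.prod ν) := by
  intro a b ha hb hab f g h hf hg hh hfgh
  rw [lintegral_prod _ hf.aemeasurable, lintegral_prod _ hg.aemeasurable,
    lintegral_prod _ hh.aemeasurable]
  refine hμ ha hb hab hf.lintegral_prod_right' hg.lintegral_prod_right' hh.lintegral_prod_right'
    fun x y => ?_
  exact hν ha hb hab (hf.comp measurable_prodMk_left) (hg.comp measurable_prodMk_left)
    (hh.comp measurable_prodMk_left) fun x' y' => hfgh (x, x') (y, y')

theorem PrekopaLeindler.of_measurePreserving {E F : Type*} [AddCommGroup E] [Module ℝ E]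
    [MeasurableSpace E] [AddCommGroup F] [Module ℝ F] [MeasurableSpace F] {μ : Measure E}
    {ν : Measure F} (hμ : PrekopaLeindler μ) {T : E → F} (hT : MeasurePreserving T μ ν)
    (hlin : IsLinearMap ℝ T) : PrekopaLeindler ν := by
  intro a b ha hb hab f g h hf hg hh hfgh
  rw [← hT.lintegral_comp hf, ← hT.lintegral_comp hg, ← hT.lintegral_comp hh]
  refine hμ ha hb hab (hf.comp hT.measurable) (hg.comp hT.measurable) (hh.comp hT.measurable)
    fun x y => ?_
  simpa [hlin.map_add, hlin.map_smul] using hfgh (T x) (T y)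

theorem prekopaLeindler_pi : ∀ n : ℕ, PrekopaLeindler (volume : Measure (Fin n → ℝ))
  | 0 => by
    intro a b ha hb hab f g h hf hg hh hfgh
    rw [volume_pi, Measure.pi_of_empty, lintegral_dirac, lintegral_dirac, lintegral_dirac]
    convert hfgh _ _ using 2
  | n + 1 => by
    refine ((prekopaLeindler_real).prod (prekopaLeindler_pi n)).of_measurePreserving
      (volume_preserving_piFinSuccAbove (fun _ : Fin (n + 1) => ℝ) 0).symm ⟨?_, ?_⟩
    · intro x y
      ext i
      refine Fin.cases ?_ (fun i => ?_) i <;> simp [MeasurableEquiv.piFinSuccAbove]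
    · intro c x
      ext i
      refine Fin.cases ?_ (fun i => ?_) i <;> simp [MeasurableEquiv.piFinSuccAbove]

theorem prekopaLeindler_space (n d : ℕ) : PrekopaLeindler (volume : Measure (Space n d)) :=
  (prekopaLeindler_pi n).prod (prekopaLeindler_pi d)

/-! ### Grünbaum's inequality -/

/-- A decreasing log-concave function lies below an exponential that touches it at `τ`, provided it
does not vanish immediately to the right of `τ`. The exponent comes from a supporting line of
`log ∘ V`. -/
theorem exists_exp_majorant {V : ℝ → ℝ} (hV : ∀ t, 0 ≤ V t) (hanti : Antitone V)
    (hlc : ∀ a b : ℝ, 0 < a → 0 < b → a + b = 1 → ∀ s t, V s ^ a * V t ^ b ≤ V (a * s + b * t))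
    {τ t₂ : ℝ} (hτ : τ < t₂) (ht₂ : 0 < V t₂) :
    ∃ s : ℝ, ∀ t, V t ≤ V τ * Real.exp (-(s * (t - τ))) := by
  have hVτ : 0 < V τ := ht₂.trans_le (hanti hτ.le)
  obtain ⟨s, hs₁, hs₂⟩ := exists_between_of_forall_le
    (s := (fun t => (Real.log (V t) - Real.log (V τ)) / (τ - t)) '' Set.Iio τ)
    (t := (fun t => (Real.log (V τ) - Real.log (V t)) / (t - τ)) '' {t | τ < t ∧ 0 < V t})
    (Set.nonempty_Iio.image _) (Set.Nonempty.image _ ⟨t₂, hτ, ht₂⟩) (by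
      rintro _ ⟨t, ht, rfl⟩ _ ⟨t', ⟨ht', hVt'⟩, rfl⟩
      have ht : t < τ := ht
      have hVt : 0 < V t := hVτ.trans_le (hanti ht.le)
      have hpos : 0 < t' - t := by linarith
      have h := hlc ((t' - τ) / (t' - t)) ((τ - t) / (t' - t)) (div_pos (by linarith) hpos)
        (div_pos (by linarith) hpos) (by field_simp; ring) t t'
      rw [show (t' - τ) / (t' - t) * t + (τ - t) / (t' - t) * t' = τ by field_simp; ring] at h
      have h2 := Real.log_le_log (by positivity) h
      rw [Real.log_mul (by positivity) (by positivity), Real.log_rpow hVt, Real.log_rpow hVt']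
        at h2
      have h3 : (t' - τ) * Real.log (V t) + (τ - t) * Real.log (V t')
          ≤ (t' - t) * Real.log (V τ) := by
        have := mul_le_mul_of_nonneg_left h2 hpos.le
        field_simp at this
        linarith
      simp only
      rw [div_le_div_iff₀ (by linarith) (by linarith)]
      linarith)
  refine ⟨s, fun t => ?_⟩
  rcases (hV t).eq_or_lt with h0 | hVt
  · rw [← h0]
    positivity
  have hlog : Real.log (V t) ≤ Real.log (V τ) + -(s * (t - τ)) := by
    rcases lt_trichotomy t τ with h | rfl | h
    · have := hs₁ (Set.mem_image_of_mem _ h)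
      rw [div_le_iff₀ (by linarith)] at this
      linarith
    · simp
    · have := hs₂ (Set.mem_image_of_mem _ ⟨h, hVt⟩)
      rw [le_div_iff₀ (by linarith)] at this
      linarith
  calc V t = Real.exp (Real.log (V t)) := (Real.exp_log hVt).symm
    _ ≤ Real.exp (Real.log (V τ) + -(s * (t - τ))) := Real.exp_le_exp.2 hlog
    _ = _ := by rw [Real.exp_add, Real.exp_log hVτ]

/-- A function whose upper tails on `C` decay like `exp (-r)` has mean at most `1` on `C`. -/
theorem setIntegral_le_of_exp_tail {E : Type*} [NormedAddCommGroup E] [MeasurableSpace E]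
    [BorelSpace E] {μ : Measure E} [IsFiniteMeasureOnCompacts μ] {C : Set E} (hC : IsCompact C)
    {f : E → ℝ} (hf : Continuous f)
    (h : ∀ r, 0 < r → μ (C ∩ {v | r < f v}) ≤ ENNReal.ofReal (μ.real C * Real.exp (-r))) :
    ∫ v in C, f v ∂μ ≤ μ.real C := by
  have hint : IntegrableOn f C μ := hf.continuousOn.integrableOn_compact hC
  have hint' : IntegrableOn (fun v => max (f v) 0) C μ :=
    (hf.max continuous_const).continuousOn.integrableOn_compact hC
  refine (integral_mono hint hint' fun v => le_max_left _ _).trans ?_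
  rw [← ENNReal.ofReal_le_ofReal_iff measureReal_nonneg,
    ofReal_integral_eq_lintegral_ofReal hint'
      (Filter.Eventually.of_forall fun v => le_max_right _ _),
    lintegral_eq_lintegral_meas_lt (f := fun v => max (f v) 0) _
      (Filter.Eventually.of_forall fun v => le_max_right _ _)
      (hf.max continuous_const).measurable.aemeasurable]
  calc ∫⁻ t in Set.Ioi 0, (μ.restrict C) {v | t < max (f v) 0}
      ≤ ∫⁻ t in Set.Ioi (0 : ℝ), ENNReal.ofReal (μ.real C * Real.exp (-t)) := by
        refine setLIntegral_mono (by fun_prop) fun t ht => ?_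
        rw [Measure.restrict_apply (measurableSet_lt measurable_const
          (hf.max continuous_const).measurable)]
        refine le_trans (measure_mono ?_) (h t ht)
        rintro v ⟨hv, hvC⟩
        refine ⟨hvC, ?_⟩
        have hv : t < max (f v) 0 := hv
        exact (lt_max_iff.1 hv).resolve_right (not_lt.2 (le_of_lt ht))
    _ = ENNReal.ofReal (∫ t in Set.Ioi (0 : ℝ), μ.real C * Real.exp (-t)) := by
        rw [ofReal_integral_eq_lintegral_ofReal]
        · exact (integrableOn_exp_neg_Ioi 0).const_mul _
        · exact Filter.Eventually.of_forall fun t => by positivity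
    _ = ENNReal.ofReal (μ.real C) := by
        rw [integral_const_mul, integral_exp_neg_Ioi_zero, mul_one]

section

variable {E : Type*} [NormedAddCommGroup E] [NormedSpace ℝ E] [MeasurableSpace E] [BorelSpace E]
  {μ : Measure E}

/-- A set containing a homothetic copy of `A` of ratio `c` has at least `c ^ dim` times its
measure. -/
theorem measure_ge_of_smul_add_mem [FiniteDimensional ℝ E] [μ.IsAddHaarMeasure] {A B : Set E}
    {c : ℝ} (hc : 0 ≤ c) (r : E) (h : ∀ v ∈ A, c • v + r ∈ B) :
    ENNReal.ofReal (c ^ Module.finrank ℝ E) * μ A ≤ μ B := by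
  rw [← Measure.addHaar_smul_of_nonneg μ hc, ← measure_preimage_add_right μ (-r)]
  refine measure_mono ?_
  intro x hx
  obtain ⟨v, hv, hvx⟩ := Set.mem_smul_set.1 (show x + -r ∈ c • A from hx)
  have := h v hv
  rwa [hvx, neg_add_cancel_right] at this

/-- The measure of the part of a convex body in a moving halfspace is log-concave, by the
Prékopa–Leindler inequality for indicator functions. -/
theorem measureReal_inter_halfspace_logConcave [IsFiniteMeasureOnCompacts μ]
    (hPL : PrekopaLeindler μ) {C : Set E} (hconv : Convex ℝ C) (hcomp : IsCompact C)
    (φ : E →L[ℝ] ℝ) {a b : ℝ} (ha : 0 < a) (hb : 0 < b) (hab : a + b = 1) (s t : ℝ) :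
    μ.real (C ∩ {v | s ≤ φ v}) ^ a * μ.real (C ∩ {v | t ≤ φ v}) ^ b
      ≤ μ.real (C ∩ {v | a * s + b * t ≤ φ v}) := by
  have hmeas : ∀ t, MeasurableSet (C ∩ {v | t ≤ φ v}) := fun t =>
    hcomp.measurableSet.inter (measurableSet_le measurable_const φ.measurable)
  have hfin : ∀ t, μ (C ∩ {v | t ≤ φ v}) ≠ ∞ := fun t =>
    ((measure_mono Set.inter_subset_left).trans_lt hcomp.measure_lt_top).ne
  have key := hPL ha hb hab (f := (C ∩ {v | s ≤ φ v}).indicator 1)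
    (g := (C ∩ {v | t ≤ φ v}).indicator 1) (h := (C ∩ {v | a * s + b * t ≤ φ v}).indicator 1)
    (measurable_one.indicator (hmeas _)) (measurable_one.indicator (hmeas _))
    (measurable_one.indicator (hmeas _)) (by
      intro x y
      by_cases hx : x ∈ C ∩ {v | s ≤ φ v}
      · by_cases hy : y ∈ C ∩ {v | t ≤ φ v}
        · have hxy : a • x + b • y ∈ C ∩ {v | a * s + b * t ≤ φ v} := by
            refine ⟨hconv hx.1 hy.1 ha.le hb.le hab, ?_⟩
            have h1 : s ≤ φ x := hx.2
            have h2 : t ≤ φ y := hy.2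
            simp only [Set.mem_ofPred_eq, map_add, map_smul, smul_eq_mul]
            gcongr
          simp [Set.indicator_of_mem, hx, hy, hxy]
        · rw [Set.indicator_of_notMem hy, ENNReal.zero_rpow_of_pos hb, mul_zero]
          exact zero_le
      · rw [Set.indicator_of_notMem hx, ENNReal.zero_rpow_of_pos ha, zero_mul]
        exact zero_le)
  rw [lintegral_indicator_one (hmeas _), lintegral_indicator_one (hmeas _),
    lintegral_indicator_one (hmeas _)] at key
  have := ENNReal.toReal_mono (hfin _) key
  rwa [ENNReal.toReal_mul, ← ENNReal.toReal_rpow, ← ENNReal.toReal_rpow] at this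

/-- Grünbaum's inequality: a closed halfspace whose boundary contains the centroid of a convex body
contains at least the fraction `1 / e` of it. -/
theorem measure_le_exp_mul_measure_inter_halfspace [CompleteSpace E]
    [IsFiniteMeasureOnCompacts μ] (hPL : PrekopaLeindler μ) {C : Set E}
    (hconv : Convex ℝ C) (hcomp : IsCompact C) (h0 : μ C ≠ 0) (φ : E →L[ℝ] ℝ) :
    μ.real C ≤ Real.exp 1 * μ.real (C ∩ {v | φ (⨍ x in C, x ∂μ) ≤ φ v}) := by
  set τ := φ (⨍ x in C, x ∂μ) with hτ
  have hCfin : μ C ≠ ∞ := hcomp.measure_lt_top.ne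
  have hVfin : ∀ s : Set E, μ (C ∩ s) ≠ ∞ := fun t =>
    ((measure_mono Set.inter_subset_left).trans_lt hcomp.measure_lt_top).ne
  have hC0 : 0 < μ.real C := ENNReal.toReal_pos h0 hCfin
  have hid : IntegrableOn (fun x : E => x) C μ :=
    continuous_id.continuousOn.integrableOn_compact hcomp
  have hφi : IntegrableOn φ C μ := φ.continuous.continuousOn.integrableOn_compact hcomp
  have hmean : ∫ v in C, (φ v - τ) ∂μ = 0 := by
    rw [integral_sub hφi (integrableOn_const hCfin), φ.integral_comp_comm hid, setIntegral_const,
      hτ, setAverage_eq, map_smul, smul_smul, mul_inv_cancel₀ hC0.ne', one_smul, sub_self]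
  have hexp : 1 ≤ Real.exp 1 := Real.one_le_exp zero_le_one
  set V : ℝ → ℝ := fun t => μ.real (C ∩ {v | t ≤ φ v}) with hV
  have hVnn : ∀ t, 0 ≤ V t := fun t => measureReal_nonneg
  have hVanti : Antitone V := fun s t hst => measureReal_mono
    (Set.inter_subset_inter_right _ fun v (hv : t ≤ φ v) => hst.trans hv) (hVfin _)
  have hle : μ.real C ≤ V τ → μ.real C ≤ Real.exp 1 * V τ := fun h =>
    h.trans (le_mul_of_one_le_left (hVnn _) hexp)
  by_cases hex : ∃ t₂, τ < t₂ ∧ 0 < V t₂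
  · obtain ⟨t₂, ht₂, hVt₂⟩ := hex
    have hVτ : 0 < V τ := hVt₂.trans_le (hVanti ht₂.le)
    obtain ⟨s, hs⟩ := exists_exp_majorant hVnn hVanti
      (fun a b ha hb hab s t => measureReal_inter_halfspace_logConcave hPL hconv hcomp φ ha hb
        hab s t) ht₂ hVt₂
    -- An exponential that does not decrease would bound the measure of all of `C`.
    rcases le_or_gt s 0 with hs0 | hs0
    · obtain ⟨t₀, ht₀⟩ := (hcomp.image φ.continuous).bddBelow
      have h1 : V (min t₀ τ) = μ.real C := by
        simp only [hV]
        congr 1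
        refine Set.inter_eq_left.2 fun v hv => (min_le_left _ _).trans (ht₀ ⟨v, hv, rfl⟩)
      refine hle ?_
      rw [← h1]
      refine (hs _).trans (mul_le_of_le_one_right (hVnn _) (Real.exp_le_one_iff.2 ?_))
      have := min_le_right t₀ τ
      nlinarith
    · set ρ := Real.log (μ.real C / V τ) with hρ
      have hρ' : Real.exp ρ = μ.real C / V τ := Real.exp_log (by positivity)
      have h1 := setIntegral_le_of_exp_tail (μ := μ) hcomp (f := fun v => ρ + s * (φ v - τ))
        (by fun_prop) (by
          intro r hr
          refine ENNReal.le_ofReal_iff_toReal_le (hVfin _) (by positivity) |>.2 ?_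
          calc μ.real (C ∩ {v | r < ρ + s * (φ v - τ)}) ≤ V (τ + (r - ρ) / s) := by
                refine measureReal_mono (Set.inter_subset_inter_right _ fun v hv => ?_) (hVfin _)
                have hv : r < ρ + s * (φ v - τ) := hv
                have : (r - ρ) / s ≤ φ v - τ := by
                  rw [div_le_iff₀ hs0]
                  linarith
                show τ + (r - ρ) / s ≤ φ v
                linarith
            _ ≤ V τ * Real.exp (-(s * (τ + (r - ρ) / s - τ))) := hs _
            _ = V τ * (Real.exp ρ * Real.exp (-r)) := by
                rw [← Real.exp_add]
                congr 2
                field_simp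
                ring
            _ = μ.real C * Real.exp (-r) := by
                rw [hρ']
                field_simp)
      have hi₁ : IntegrableOn (fun _ : E => ρ) C μ := integrableOn_const hCfin
      have hi₂ : IntegrableOn (fun v => s * (φ v - τ)) C μ :=
        Continuous.continuousOn (by fun_prop) |>.integrableOn_compact hcomp
      rw [integral_add hi₁ hi₂, integral_const_mul, hmean,
        setIntegral_const, mul_zero, add_zero, smul_eq_mul] at h1
      have h2 : ρ ≤ 1 := le_of_mul_le_mul_left (by simpa using h1) hC0
      have h3 := Real.exp_le_exp.2 h2
      rwa [hρ', div_le_iff₀ hVτ] at h3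
  · -- Here `φ ≤ τ` almost everywhere on `C`, and as `τ` is the mean of `φ`, equality holds.
    push Not at hex
    refine hle ?_
    have hnull : μ (C ∩ {v | τ < φ v}) = 0 := by
      have : C ∩ {v | τ < φ v} ⊆ ⋃ m : ℕ, C ∩ {v | τ + 1 / ((m : ℝ) + 1) ≤ φ v} := by
        rintro v ⟨hv, hv'⟩
        obtain ⟨m, hm⟩ := exists_nat_one_div_lt (sub_pos.2 (show τ < φ v from hv'))
        refine Set.mem_iUnion.2 ⟨m, hv, ?_⟩
        show τ + 1 / ((m : ℝ) + 1) ≤ φ v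
        linarith
      refine measure_mono_null this (measure_iUnion_null fun m => ?_)
      have hpos : (0 : ℝ) < 1 / ((m : ℝ) + 1) := by positivity
      have := le_antisymm (hex (τ + 1 / ((m : ℝ) + 1)) (by linarith)) (hVnn _)
      exact (measureReal_eq_zero_iff (hVfin _)).1 this
    have hCm := hcomp.measurableSet
    have hae : ∀ᵐ v ∂(μ.restrict C), φ v ≤ τ := by
      rw [ae_restrict_iff' hCm, ae_iff]
      refine measure_mono_null ?_ hnull
      intro v hv
      simp only [Set.mem_ofPred_eq, Classical.not_imp, not_le] at hv
      exact hv
    have hzero : ∫ v in C, (τ - φ v) ∂μ = 0 := by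
      rw [← neg_eq_zero, ← integral_neg]
      simpa using hmean
    have hae2 := (integral_eq_zero_iff_of_nonneg_ae (hae.mono fun v hv => sub_nonneg.2 hv)
      ((integrableOn_const hCfin).sub hφi)).1 hzero
    have hnull2 : μ (C \ (C ∩ {v | τ ≤ φ v})) = 0 := by
      have := (ae_restrict_iff' hCm).1 hae2
      rw [ae_iff] at this
      refine measure_mono_null ?_ this
      rintro v ⟨hv, hv'⟩
      simp only [Set.mem_ofPred_eq, Classical.not_imp]
      refine ⟨hv, fun h => hv' ⟨hv, ?_⟩⟩
      have h : τ - φ v = 0 := h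
      show τ ≤ φ v
      linarith
    have : μ C ≤ μ (C ∩ {v | τ ≤ φ v}) := by
      calc μ C ≤ μ ((C ∩ {v | τ ≤ φ v}) ∪ (C \ (C ∩ {v | τ ≤ φ v}))) := by
            rw [Set.union_sdiff_self]
            exact measure_mono Set.subset_union_right
        _ ≤ _ := (measure_union_le _ _).trans (by rw [hnull2, add_zero])
    exact ENNReal.toReal_mono (hVfin _) this

/-- Grünbaum's inequality for a halfspace containing a point `(1 - t) • g + t • p`, with `g` the
centroid of `C` and `p ∈ C`: this point is the centroid of a homothetic copy of `C` inside `C`. -/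
theorem measure_inter_halfspace_ge [FiniteDimensional ℝ E] [μ.IsAddHaarMeasure]
    (hPL : PrekopaLeindler μ) {C : Set E}
    (hconv : Convex ℝ C) (hcomp : IsCompact C) (h0 : μ C ≠ 0) (φ : E →L[ℝ] ℝ) {p : E}
    (hp : p ∈ C) {t c : ℝ} (ht0 : 0 ≤ t) (ht1 : t ≤ 1)
    (hc : c ≤ (1 - t) * φ (⨍ x in C, x ∂μ) + t * φ p) :
    (1 - t) ^ Module.finrank ℝ E / Real.exp 1 * μ.real C ≤ μ.real (C ∩ {v | c ≤ φ v}) := by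
  have hVfin : ∀ s : Set E, μ (C ∩ s) ≠ ∞ := fun t =>
    ((measure_mono Set.inter_subset_left).trans_lt hcomp.measure_lt_top).ne
  have := FiniteDimensional.complete ℝ E
  have h1 := measure_le_exp_mul_measure_inter_halfspace hPL hconv hcomp h0 φ
  have h2 := measure_ge_of_smul_add_mem (μ := μ)
    (A := C ∩ {v | φ (⨍ x in C, x ∂μ) ≤ φ v}) (B := C ∩ {v | c ≤ φ v})
    (sub_nonneg.2 ht1) (t • p) (by
      rintro v ⟨hv, hv'⟩
      have hv' : φ (⨍ x in C, x ∂μ) ≤ φ v := hv'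
      refine ⟨hconv hv hp (sub_nonneg.2 ht1) ht0 (by ring), hc.trans ?_⟩
      simp only [map_add, map_smul, smul_eq_mul]
      have := mul_le_mul_of_nonneg_left hv' (sub_nonneg.2 ht1)
      linarith)
  have h3 := ENNReal.toReal_mono (hVfin _) h2
  have hpow : 0 ≤ (1 - t) ^ Module.finrank ℝ E := pow_nonneg (sub_nonneg.2 ht1) _
  rw [ENNReal.toReal_mul, ENNReal.toReal_ofReal hpow] at h3
  refine le_trans ?_ h3
  rw [div_mul_eq_mul_div, mul_div_assoc]
  refine mul_le_mul_of_nonneg_left ?_ hpow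
  rw [div_le_iff₀ (Real.exp_pos 1), mul_comm]
  exact h1

end

/-! ### Comparison of volume and mixed-integer volume -/

section Volume

variable {n d : ℕ}

theorem fiber_points_inter (C H : Set (Space n d)) (z : Fin n → ℤ) :
    fiber (points C ∩ H) (fun i => (z i : ℝ)) = fiber (C ∩ H) (fun i => (z i : ℝ)) := by
  ext x
  exact ⟨fun h => ⟨h.1.1, h.2⟩, fun h => ⟨⟨h.1, fun i => ⟨z i, rfl⟩⟩, h.2⟩⟩

theorem mixedVolume_points_inter (C H : Set (Space n d)) :
    mixedVolume (points C ∩ H) = mixedVolume (C ∩ H) := by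
  simp only [mixedVolume, fiber_points_inter]

theorem mixedVolume_points (C : Set (Space n d)) : mixedVolume (points C) = mixedVolume C := by
  simpa using mixedVolume_points_inter C Set.univ

/-- The measure on `ℝ^n × ℝ^d` given on measurable sets by the mixed-integer volume. -/
noncomputable def mixedMeasure (n d : ℕ) : Measure (Space n d) :=
  Measure.sum fun z : Fin n → ℤ =>
    Measure.map (fun x : Fin d → ℝ => ((fun i => (z i : ℝ) : Fin n → ℝ), x)) volume

theorem mixedMeasure_apply {A : Set (Space n d)} (hA : MeasurableSet A) :
    mixedMeasure n d A = mixedVolume A := by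
  rw [mixedMeasure, Measure.sum_apply _ hA, mixedVolume]
  congr 1 with z
  rw [Measure.map_apply measurable_prodMk_left hA]
  rfl

theorem volume_eq_lintegral_fiber {A : Set (Space n d)} (hA : MeasurableSet A) :
    volume A = ∫⁻ w, volume (fiber A w) :=
  Measure.prod_apply hA

theorem measurable_volume_fiber {A : Set (Space n d)} (hA : MeasurableSet A) :
    Measurable fun w => volume (fiber A w) :=
  measurable_measure_prodMk_left hA

theorem measurable_round : Measurable fun (w : Fin n → ℝ) i => round (w i) := by
  refine measurable_pi_lambda _ fun i => ?_
  simp only [round_eq]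
  exact ((measurable_pi_apply i).add_const _).floor

/-- Rounding to the nearest integer point maps Lebesgue measure to counting measure. -/
theorem map_round_volume :
    Measure.map (fun (w : Fin n → ℝ) i => round (w i)) volume = Measure.count := by
  refine Measure.ext_of_singleton fun z => ?_
  rw [Measure.map_apply measurable_round (measurableSet_singleton z), Measure.count_singleton]
  have : (fun (w : Fin n → ℝ) i => round (w i)) ⁻¹' {z}
      = Set.univ.pi fun i => Set.Ico ((z i : ℝ) - 1 / 2) (z i + 1 / 2) := by
    ext w
    simp only [Set.mem_preimage, Set.mem_singleton_iff, funext_iff, Set.mem_univ_pi, Set.mem_Ico,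
      round_eq, Int.floor_eq_iff]
    refine forall_congr' fun i => ?_
    constructor <;> rintro ⟨h, h'⟩ <;> constructor <;> linarith
  rw [this, volume_pi_pi]
  refine Finset.prod_eq_one fun i _ => ?_
  rw [Real.volume_Ico]
  norm_num

theorem lintegral_comp_round (G : (Fin n → ℤ) → ℝ≥0∞) :
    ∫⁻ w : Fin n → ℝ, G (fun i => round (w i)) = ∑' z, G z := by
  rw [← lintegral_count, ← map_round_volume, lintegral_map (measurable_of_countable G)
    measurable_round]

theorem lintegral_eq_mul_lintegral_comp_smul_add {c : ℝ} (hc : 0 < c) (b : Fin n → ℝ)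
    {F : (Fin n → ℝ) → ℝ≥0∞} (hF : Measurable F) :
    ∫⁻ w, F w = ENNReal.ofReal (c ^ n) * ∫⁻ w, F (c • w + b) := by
  rw [← lintegral_add_right_eq_self F b]
  have hF' : Measurable fun w => F (w + b) := hF.comp (measurable_add_const b)
  have h := lintegral_map hF' (measurable_const_smul c) (μ := (volume : Measure (Fin n → ℝ)))
  rw [Measure.map_addHaar_smul _ hc.ne', lintegral_smul_measure, Module.finrank_fin_fun,
    abs_of_pos (by positivity), ENNReal.ofReal_inv_of_pos (by positivity)] at h
  rw [← h, smul_eq_mul, ← mul_assoc, ENNReal.mul_inv_cancel, one_mul]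
  · simpa using pow_pos hc n
  · exact ENNReal.ofReal_ne_top

/-- If the homothety of ratio `c` towards `r` maps `A` into `B`, then the fibers of `B` are large
compared with the corresponding fibers of `A`. The point `r` may depend on the fiber. -/
theorem volume_fiber_le {A B : Set (Space n d)} {c l : ℝ} (hc : 0 ≤ c) {w z : Fin n → ℝ}
    {r : Space n d} (hz : z = c • w + l • r.1) (hr : ∀ v ∈ A, c • v + l • r ∈ B) :
    ENNReal.ofReal (c ^ d) * volume (fiber A w) ≤ volume (fiber B z) := by
  have := measure_ge_of_smul_add_mem (μ := (volume : Measure (Fin d → ℝ))) (A := fiber A w)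
    (B := fiber B z) hc (l • r.2) (by
      intro x hx
      have := hr (w, x) hx
      rw [hz]
      exact this)
  rwa [Module.finrank_fin_fun] at this

theorem norm_smul_sub_round_le {l κ c : ℝ} (hlκ : 1 / 2 ≤ l * κ) (hc : 0 ≤ c) (hc1 : c ≤ 1)
    (w : Fin n → ℝ) : ‖(c / (l * κ)) • (w - fun i => (round (w i) : ℝ))‖ ≤ 1 := by
  have hpos : 0 < l * κ := by linarith
  rw [norm_smul, Real.norm_of_nonneg (by positivity)]
  have h1 : ‖w - fun i => (round (w i) : ℝ)‖ ≤ 1 / 2 :=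
    (pi_norm_le_iff_of_nonneg (by norm_num)).2 fun i => abs_sub_round (w i)
  calc c / (l * κ) * ‖w - fun i => (round (w i) : ℝ)‖ ≤ 1 / (l * κ) * (1 / 2) := by gcongr
    _ ≤ 1 := by
      rw [div_mul_eq_mul_div, div_le_one hpos]
      linarith

variable {A B : Set (Space n d)} {l κ : ℝ} {w₀ : Fin n → ℝ}

/-- Rounding from real to integral fibers: the homothety towards a suitable `r` over `w₀ + κ • u`
moves any given fiber of `A` to a fiber of `B` over an integer point. -/
theorem volume_le_mixedVolume (hA : MeasurableSet A) (hl1 : l < 1)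
    (hlκ : 1 / 2 ≤ l * κ)
    (hr : ∀ u : Fin n → ℝ, ‖u‖ ≤ 1 → ∃ r : Space n d, r.1 = w₀ + κ • u ∧
      ∀ v ∈ A, (1 - l) • v + l • r ∈ B) :
    ENNReal.ofReal ((1 - l) ^ (n + d)) * volume A ≤ mixedVolume B := by
  have hc : 0 < 1 - l := by linarith
  have hpos : l * κ ≠ 0 := by linarith
  set G : (Fin n → ℤ) → ℝ≥0∞ := fun z => volume (fiber B fun i => (z i : ℝ)) with hG
  have hGm : Measurable fun w : Fin n → ℝ => G fun i => round (w i) :=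
    (measurable_of_countable G).comp measurable_round
  rw [mixedVolume, ← lintegral_comp_round G,
    lintegral_eq_mul_lintegral_comp_smul_add hc (l • w₀) hGm, volume_eq_lintegral_fiber hA,
    pow_add, ENNReal.ofReal_mul (by positivity), mul_assoc]
  gcongr
  rw [← lintegral_const_mul _ (measurable_volume_fiber hA)]
  refine lintegral_mono fun w => ?_
  set w' := (1 - l) • w + l • w₀ with hw'
  obtain ⟨r, hr1, hrB⟩ := hr (-((1 / (l * κ)) • (w' - fun i => (round (w' i) : ℝ))))
    (by rw [norm_neg]; exact norm_smul_sub_round_le hlκ zero_le_one le_rfl w')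
  refine volume_fiber_le hc.le ?_ hrB
  rw [hr1, smul_add, smul_neg, smul_neg, smul_smul, smul_smul, mul_one_div_cancel hpos, one_smul,
    ← add_assoc, ← hw']
  abel

/-- Rounding from integral to real fibers: the fiber of `A` over an integer point is moved to the
fibers of `B` over a whole cell around its image. -/
theorem mixedVolume_le_volume (hB : MeasurableSet B) (hl0 : 0 ≤ l)
    (hl1 : l < 1) (hlκ : 1 / 2 ≤ l * κ)
    (hr : ∀ u : Fin n → ℝ, ‖u‖ ≤ 1 → ∃ r : Space n d, r.1 = w₀ + κ • u ∧
      ∀ v ∈ A, (1 - l) • v + l • r ∈ B) :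
    ENNReal.ofReal ((1 - l) ^ (n + d)) * mixedVolume A ≤ volume B := by
  have hc : 0 < 1 - l := by linarith
  have hpos : l * κ ≠ 0 := by linarith
  set G : (Fin n → ℤ) → ℝ≥0∞ := fun z => volume (fiber A fun i => (z i : ℝ)) with hG
  have hGm : Measurable fun w : Fin n → ℝ => G fun i => round (w i) :=
    (measurable_of_countable G).comp measurable_round
  rw [mixedVolume, ← lintegral_comp_round G, volume_eq_lintegral_fiber hB,
    lintegral_eq_mul_lintegral_comp_smul_add hc (l • w₀) (measurable_volume_fiber hB),
    pow_add, ENNReal.ofReal_mul (by positivity), mul_assoc]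
  gcongr
  rw [← lintegral_const_mul _ hGm]
  refine lintegral_mono fun w => ?_
  obtain ⟨r, hr1, hrB⟩ := hr (((1 - l) / (l * κ)) • (w - fun i => (round (w i) : ℝ)))
    (norm_smul_sub_round_le hlκ hc.le (by linarith) w)
  refine volume_fiber_le hc.le ?_ hrB
  rw [hr1, smul_add, smul_smul, smul_smul, mul_div_cancel₀ _ hpos, smul_sub]
  abel

end Volume

/-! ### Existence of centerpoints -/

section Depth

variable {n d : ℕ}

/-- The linear functional `y ↦ aᵀ y` on `ℝ^n × ℝ^d`. -/
noncomputable def pairing (a : Space n d) : Space n d →L[ℝ] ℝ :=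
  ∑ i, a.1 i • (ContinuousLinearMap.proj i).comp (ContinuousLinearMap.fst ℝ _ _) +
    ∑ j, a.2 j • (ContinuousLinearMap.proj j).comp (ContinuousLinearMap.snd ℝ _ _)

theorem pairing_apply (a y : Space n d) :
    pairing a y = ∑ i, a.1 i * y.1 i + ∑ j, a.2 j * y.2 j := by
  simp [pairing]

theorem isClosedHalfspace_iff {H : Set (Space n d)} :
    IsClosedHalfspace H ↔ ∃ (a : Space n d) (c : ℝ), a ≠ 0 ∧ H = {y | c ≤ pairing a y} := by
  simp only [IsClosedHalfspace, pairing_apply]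

theorem isClosed_lattice : IsClosed (lattice n d) := by
  have : lattice n d = ⋂ i, (fun y : Space n d => y.1 i) ⁻¹' Set.range ((↑) : ℤ → ℝ) := by
    ext y
    simp only [Set.mem_iInter, Set.mem_preimage, Set.mem_range]
    rfl
  rw [this]
  exact isClosed_iInter fun i => Int.isClosedEmbedding_coe_real.isClosed_range.preimage
    (by fun_prop)

theorem depth_le {S H : Set (Space n d)} {y : Space n d} (hH : IsClosedHalfspace H) (hy : y ∈ H) :
    depth S y ≤ mixedVolume (S ∩ H) :=
  sInf_le ⟨H, hH, hy, rfl⟩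

/-- A halfspace `{c ≤ φ}` of small mixed-integer volume can be enlarged to `{c - ε ≤ φ}` without
making the volume much larger, and the enlarged halfspace contains all points near the original
one. -/
theorem upperSemicontinuous_depth_points {C : Set (Space n d)} (hC : IsCompact C)
    (hfin : mixedVolume C ≠ ∞) : UpperSemicontinuous (depth (points C)) := by
  intro y v hv
  obtain ⟨_, ⟨H, hH, hy, rfl⟩, hHv⟩ := sInf_lt_iff.1 hv
  obtain ⟨a, c, ha, rfl⟩ := isClosedHalfspace_iff.1 hH
  rw [mixedVolume_points_inter] at hHv
  have hmeas : ∀ c : ℝ, MeasurableSet (C ∩ {y | c ≤ pairing a y}) := fun c =>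
    hC.measurableSet.inter (measurableSet_le measurable_const (pairing a).measurable)
  have hlim : Filter.Tendsto
      (fun m : ℕ => mixedMeasure n d (C ∩ {y | c - 1 / ((m : ℝ) + 1) ≤ pairing a y})) Filter.atTop
      (nhds (mixedMeasure n d (⋂ m : ℕ, C ∩ {y | c - 1 / ((m : ℝ) + 1) ≤ pairing a y}))) := by
    refine tendsto_measure_iInter_atTop (fun m => (hmeas _).nullMeasurableSet) ?_ ⟨0, ?_⟩
    · intro m m' hmm
      refine Set.inter_subset_inter_right _ fun y hy => ?_
      have hy : c - 1 / ((m' : ℝ) + 1) ≤ pairing a y := hy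
      have : 1 / ((m' : ℝ) + 1) ≤ 1 / ((m : ℝ) + 1) := by gcongr
      show c - 1 / ((m : ℝ) + 1) ≤ pairing a y
      linarith
    · refine ((measure_mono Set.inter_subset_left).trans_lt ?_).ne
      rw [mixedMeasure_apply hC.measurableSet]
      exact hfin.lt_top
  have hInter : ⋂ m : ℕ, C ∩ {y | c - 1 / ((m : ℝ) + 1) ≤ pairing a y}
      = C ∩ {y | c ≤ pairing a y} := by
    ext x
    simp only [Set.mem_iInter]
    constructor
    · intro h
      refine ⟨(h 0).1, ?_⟩
      refine not_lt.1 fun (hlt : pairing a x < c) => ?_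
      obtain ⟨m, hm⟩ := exists_nat_one_div_lt (sub_pos.2 hlt)
      have : c - 1 / ((m : ℝ) + 1) ≤ pairing a x := (h m).2
      linarith
    · rintro ⟨hx, hx'⟩ m
      have hx' : c ≤ pairing a x := hx'
      refine ⟨hx, ?_⟩
      show c - 1 / ((m : ℝ) + 1) ≤ pairing a x
      have : 0 < 1 / ((m : ℝ) + 1) := by positivity
      linarith
  rw [hInter, mixedMeasure_apply (hmeas c)] at hlim
  obtain ⟨m, hm⟩ := (hlim.eventually_lt_const hHv).exists
  rw [mixedMeasure_apply (hmeas _)] at hm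
  have hopen : IsOpen {y' | c - 1 / ((m : ℝ) + 1) < pairing a y'} :=
    isOpen_lt continuous_const (pairing a).continuous
  have hy : c ≤ pairing a y := hy
  have hmem : y ∈ {y' | c - 1 / ((m : ℝ) + 1) < pairing a y'} := by
    have : 0 < 1 / ((m : ℝ) + 1) := by positivity
    show c - 1 / ((m : ℝ) + 1) < pairing a y
    linarith
  filter_upwards [hopen.mem_nhds hmem] with y' hy'
  refine (depth_le (isClosedHalfspace_iff.2 ⟨a, _, ha, rfl⟩) (le_of_lt hy')).trans_lt ?_
  rwa [mixedVolume_points_inter]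

theorem centerpoints_points_nonempty {C : Set (Space n d)} (hC : IsCompact C)
    (hfin : mixedVolume C ≠ ∞) (hne : (points C).Nonempty) :
    (centerpoints (points C)).Nonempty := by
  obtain ⟨y, hy, hmax⟩ := ((upperSemicontinuous_depth_points hC hfin).upperSemicontinuousOn
    (points C)).exists_isMaxOn hne (hC.inter_right isClosed_lattice)
  exact ⟨y, hy, fun y' hy' => hmax hy'⟩

end Depth

/-! ### A mixed-integer point of large depth -/

instance (n d : ℕ) : (volume : Measure (Space n d)).IsAddHaarMeasure :=
  Measure.prod.instIsAddHaarMeasure _ _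

section DeepPoint

variable {n d : ℕ} {C : Set (Space n d)} {z₀ : Fin n → ℝ} {k : ℝ}

/-- In a compact set over the cube `z₀ + k • u`, either the average of `φ` at a fixed point `top`
and at suitable points over the cube is always at least `σ`, or the average at a fixed point `bot` and
at points over the cube, with the weights exchanged, is always at most `σ`. For `top` a maximizer of
`φ`, failure of the first alternative at `u₁` lets any point over `u₁` serve as `bot`. -/
theorem exists_high_or_low_section (hcomp : IsCompact C) (hne : C.Nonempty)
    (hcube : ∀ u : Fin n → ℝ, ‖u‖ ≤ 1 → ∃ r ∈ C, r.1 = z₀ + k • u)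
    (φ : Space n d →L[ℝ] ℝ) (σ : ℝ) {s : ℝ} (hs1 : s ≤ 1) :
    (∃ top ∈ C, ∀ u : Fin n → ℝ, ‖u‖ ≤ 1 →
      ∃ r ∈ C, r.1 = z₀ + k • u ∧ σ ≤ (1 - s) * φ top + s * φ r) ∨
    (∃ bot ∈ C, ∀ u : Fin n → ℝ, ‖u‖ ≤ 1 →
      ∃ r ∈ C, r.1 = z₀ + k • u ∧ s * φ bot + (1 - s) * φ r ≤ σ) := by
  obtain ⟨top, htop, hmax⟩ := hcomp.exists_isMaxOn hne φ.continuous.continuousOn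
  by_cases h : ∀ u : Fin n → ℝ, ‖u‖ ≤ 1 →
      ∃ r ∈ C, r.1 = z₀ + k • u ∧ σ ≤ (1 - s) * φ top + s * φ r
  · exact Or.inl ⟨top, htop, h⟩
  · push Not at h
    obtain ⟨u₁, hu₁, hlow⟩ := h
    obtain ⟨bot, hbot, hbot₁⟩ := hcube u₁ hu₁
    refine Or.inr ⟨bot, hbot, fun u hu => ?_⟩
    obtain ⟨r, hr, hr₁⟩ := hcube u hu
    refine ⟨r, hr, hr₁, ?_⟩
    have h1 := hlow bot hbot hbot₁
    have h2 : (1 - s) * φ r ≤ (1 - s) * φ top :=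
      mul_le_mul_of_nonneg_left (hmax hr) (sub_nonneg.2 hs1)
    linarith

/-- Bernoulli's inequality for a step `t ≤ q / k`. -/
theorem one_sub_le_pow {N : ℕ} {ε t q : ℝ} (ht1 : t ≤ 1) (hq : 0 ≤ q)
    (htq : t ≤ q / k) (hNk : N / k ≤ ε / 3) : 1 - q * ε / 3 ≤ (1 - t) ^ N := by
  have h1 := one_add_mul_le_pow (a := -t) (by linarith) N
  have h2 : (N : ℝ) * t ≤ q * (ε / 3) := by
    calc (N : ℝ) * t ≤ N * (q / k) := by gcongr
      _ = q * (N / k) := by ring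
      _ ≤ q * (ε / 3) := by gcongr
  rw [← sub_eq_add_neg] at h1
  linarith

/-- The volume of `C` in a halfspace bounds its mixed-integer volume in a nearby halfspace from
below. The points `(1 - s) • top + s • r` used for rounding lie over a translate of the cube scaled
by `s`, and all of them have `φ`-value at least `σ`. -/
theorem volume_halfspace_le_mixedVolume (hconv : Convex ℝ C) (hcomp : IsCompact C)
    (φ : Space n d →L[ℝ] ℝ) {s l γ σ c : ℝ} (hs0 : 0 ≤ s) (hs1 : s ≤ 1) (hl0 : 0 ≤ l) (hl1 : l < 1)
    (hlsk : 1 / 2 ≤ l * (s * k)) {top : Space n d} (htop : top ∈ C)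
    (hsec : ∀ u : Fin n → ℝ, ‖u‖ ≤ 1 →
      ∃ r ∈ C, r.1 = z₀ + k • u ∧ σ ≤ (1 - s) * φ top + s * φ r)
    (hc : c ≤ (1 - l) * γ + l * σ) :
    ENNReal.ofReal ((1 - l) ^ (n + d)) * volume (C ∩ {v | γ ≤ φ v})
      ≤ mixedVolume (C ∩ {v | c ≤ φ v}) := by
  refine volume_le_mixedVolume (w₀ := (1 - s) • top.1 + s • z₀)
    (hcomp.measurableSet.inter (measurableSet_le measurable_const φ.measurable)) hl1 hlsk
    fun u hu => ?_
  obtain ⟨r, hr, hr₁, hσ⟩ := hsec u hu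
  refine ⟨(1 - s) • top + s • r, ?_, ?_⟩
  · rw [Prod.fst_add, Prod.smul_fst, Prod.smul_fst, hr₁, smul_add, smul_smul, ← add_assoc]
  · rintro v ⟨hv, hv'⟩
    refine ⟨hconv hv (hconv htop hr (by linarith) hs0 (by ring)) (by linarith) hl0 (by ring),
      hc.trans ?_⟩
    simp only [map_add, map_smul, smul_eq_mul]
    have h1 := mul_le_mul_of_nonneg_left (show γ ≤ φ v from hv') (show 0 ≤ 1 - l by linarith)
    have h2 := mul_le_mul_of_nonneg_left hσ hl0
    linarith

/-- The counterpart of `volume_halfspace_le_mixedVolume` for open halfspaces `{φ < c}`, with the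
rounding points `s • bot + (1 - s) • r` of `φ`-value at most `σ`. -/
theorem mixedVolume_open_halfspace_le_volume (hconv : Convex ℝ C) (hcomp : IsCompact C)
    (φ : Space n d →L[ℝ] ℝ) {s l σ c b : ℝ} (hs0 : 0 ≤ s) (hs1 : s ≤ 1) (hl0 : 0 ≤ l) (hl1 : l < 1)
    (hlsk : 1 / 2 ≤ l * ((1 - s) * k)) {bot : Space n d} (hbot : bot ∈ C)
    (hsec : ∀ u : Fin n → ℝ, ‖u‖ ≤ 1 →
      ∃ r ∈ C, r.1 = z₀ + k • u ∧ s * φ bot + (1 - s) * φ r ≤ σ)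
    (hb : (1 - l) * c + l * σ ≤ b) :
    ENNReal.ofReal ((1 - l) ^ (n + d)) * mixedVolume (C ∩ {v | φ v < c})
      ≤ volume (C ∩ {v | φ v < b}) := by
  refine mixedVolume_le_volume (w₀ := s • bot.1 + (1 - s) • z₀)
    (hcomp.measurableSet.inter (measurableSet_lt φ.measurable measurable_const)) hl0 hl1 hlsk
    fun u hu => ?_
  obtain ⟨r, hr, hr₁, hσ⟩ := hsec u hu
  refine ⟨s • bot + (1 - s) • r, ?_, ?_⟩
  · rw [Prod.fst_add, Prod.smul_fst, Prod.smul_fst, hr₁, smul_add, smul_smul, ← add_assoc]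
  · rintro v ⟨hv, hv'⟩
    refine ⟨hconv hv (hconv hbot hr hs0 (by linarith) (by ring)) (by linarith) hl0 (by ring),
      lt_of_lt_of_le ?_ hb⟩
    simp only [map_add, map_smul, smul_eq_mul]
    have h1 := mul_lt_mul_of_pos_left (show φ v < c from hv') (show 0 < 1 - l by linarith)
    have h2 := mul_le_mul_of_nonneg_left hσ hl0
    linarith

/-- With rounding points anywhere in `C`, the step `1 / (2 * k)` suffices and `C` is mapped into
itself. -/
theorem exists_rounding_point (hconv : Convex ℝ C) (hk : 1 / 2 < k)
    (hcube : ∀ u : Fin n → ℝ, ‖u‖ ≤ 1 → ∃ r ∈ C, r.1 = z₀ + k • u) (u : Fin n → ℝ) (hu : ‖u‖ ≤ 1) :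
    ∃ r : Space n d, r.1 = z₀ + k • u ∧
      ∀ v ∈ C, (1 - 1 / (2 * k)) • v + (1 / (2 * k)) • r ∈ C := by
  obtain ⟨r, hr, hr₁⟩ := hcube u hu
  have h1 : 1 / (2 * k) ≤ 1 := by
    rw [div_le_one (by linarith)]
    linarith
  have h0 : 0 ≤ 1 / (2 * k) := by
    have : 0 < k := by linarith
    positivity
  exact ⟨r, hr₁, fun v hv => hconv hv hr (by linarith) h0 (by ring)⟩

theorem one_div_two_mul_lt_one (hk : 1 / 2 < k) : 1 / (2 * k) < 1 := by
  rw [div_lt_one (by linarith)]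
  linarith

theorem half_le_one_div_two_mul_mul (hk : 1 / 2 < k) : 1 / 2 ≤ 1 / (2 * k) * k :=
  le_of_eq (by have : k ≠ 0 := by linarith
               field_simp)

theorem mul_volume_le_mixedVolume (hconv : Convex ℝ C) (hcomp : IsCompact C) (hk : 1 / 2 < k)
    (hcube : ∀ u : Fin n → ℝ, ‖u‖ ≤ 1 → ∃ r ∈ C, r.1 = z₀ + k • u) :
    ENNReal.ofReal ((1 - 1 / (2 * k)) ^ (n + d)) * volume C ≤ mixedVolume C :=
  volume_le_mixedVolume hcomp.measurableSet (one_div_two_mul_lt_one hk)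
    (half_le_one_div_two_mul_mul hk) (exists_rounding_point hconv hk hcube)

theorem mul_mixedVolume_le_volume (hconv : Convex ℝ C) (hcomp : IsCompact C) (hk : 1 / 2 < k)
    (hcube : ∀ u : Fin n → ℝ, ‖u‖ ≤ 1 → ∃ r ∈ C, r.1 = z₀ + k • u) :
    ENNReal.ofReal ((1 - 1 / (2 * k)) ^ (n + d)) * mixedVolume C ≤ volume C :=
  mixedVolume_le_volume hcomp.measurableSet
    (div_nonneg zero_le_one (by linarith)) (one_div_two_mul_lt_one hk)
    (half_le_one_div_two_mul_mul hk) (exists_rounding_point hconv hk hcube)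

theorem mixedVolume_ne_top (hconv : Convex ℝ C) (hcomp : IsCompact C) (hk : 1 / 2 < k)
    (hcube : ∀ u : Fin n → ℝ, ‖u‖ ≤ 1 → ∃ r ∈ C, r.1 = z₀ + k • u) : mixedVolume C ≠ ∞ := by
  intro h
  have hpos : 0 < (1 - 1 / (2 * k)) ^ (n + d) :=
    pow_pos (sub_pos.2 (one_div_two_mul_lt_one hk)) _
  have hle := mul_mixedVolume_le_volume hconv hcomp hk hcube
  rw [h, ENNReal.mul_top (by simpa using hpos), top_le_iff] at hle
  exact hcomp.measure_lt_top.ne hle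

/-- Every point `g` of `C` can be moved to a point of the lattice `ℤ^n × ℝ^d` by a small step
towards a point of `C`. -/
theorem exists_convexComb_mem_points (hconv : Convex ℝ C) (hk : 1 / 2 < k)
    (hcube : ∀ u : Fin n → ℝ, ‖u‖ ≤ 1 → ∃ r ∈ C, r.1 = z₀ + k • u) {g : Space n d} (hg : g ∈ C) :
    ∃ p ∈ C, (1 - 1 / (2 * k)) • g + (1 / (2 * k)) • p ∈ points C := by
  have hlk := half_le_one_div_two_mul_mul hk
  have hl1 := one_div_two_mul_lt_one hk
  set l := 1 / (2 * k)
  set w : Fin n → ℝ := (1 - l) • g.1 + l • z₀ with hw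
  obtain ⟨p, hp, hp₁⟩ := hcube (-((1 / (l * k)) • (w - fun i => (round (w i) : ℝ))))
    (by rw [norm_neg]; exact norm_smul_sub_round_le hlk zero_le_one le_rfl w)
  have hfst : ((1 - l) • g + l • p).1 = fun i => (round (w i) : ℝ) := by
    have hne0 : l * k ≠ 0 := by linarith
    rw [Prod.fst_add, Prod.smul_fst, Prod.smul_fst, hp₁, smul_add, smul_neg, smul_neg,
      smul_smul, smul_smul, mul_one_div_cancel hne0, one_smul, ← add_assoc, ← hw]
    abel
  have hl0 : 0 ≤ l := div_nonneg zero_le_one (by linarith)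
  exact ⟨p, hp, hconv hg hp (by linarith) hl0 (by ring), fun i => ⟨round (w i), by rw [hfst]⟩⟩

theorem half_mul_le_of_high_section {ε X M : ℝ} (hε0 : 0 ≤ ε) (hε : ε ≤ 1 / 2) (hM : 0 ≤ M)
    (hMX : (1 - 1 / 2 * ε / 3) * M ≤ X) : ε / 2 * M ≤ (1 - 2 * ε / 3) * (ε * X) := by
  have h1 : 0 ≤ 1 - 2 * ε / 3 := by linarith
  refine le_trans ?_ (mul_le_mul_of_nonneg_left (mul_le_mul_of_nonneg_left hMX hε0) h1)
  have h2 : 0 ≤ 1 / 2 - 5 * ε / 6 + ε ^ 2 / 9 := by nlinarith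
  have h3 : 0 ≤ ε * M * (1 / 2 - 5 * ε / 6 + ε ^ 2 / 9) := by positivity
  linarith

theorem le_one_sub_half_mul_of_low_section {ε X M D : ℝ} (hε0 : 0 ≤ ε) (hε : ε ≤ 1 / 2)
    (hM : 0 ≤ M) (hXM : (1 - 1 / 2 * ε / 3) * X ≤ M)
    (hD : (1 - 2 / 3 * ε / 3) * D ≤ (1 - (1 - 2 / 3 * ε / 3) * ε) * X) :
    D ≤ (1 - ε / 2) * M := by
  have hα : 0 < 1 - 2 / 3 * ε / 3 := by linarith
  have hβ : 0 < 1 - 1 / 2 * ε / 3 := by linarith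
  have hγ : 0 ≤ 1 - (1 - 2 / 3 * ε / 3) * ε := by nlinarith
  have h1 := mul_le_mul_of_nonneg_left hD hβ.le
  have h2 := mul_le_mul_of_nonneg_left hXM hγ
  have h3 : 1 - (1 - 2 / 3 * ε / 3) * ε
      ≤ (1 - 2 / 3 * ε / 3) * (1 - 1 / 2 * ε / 3) * (1 - ε / 2) := by
    have h4 : 0 ≤ ε * (1 / 9 + ε / 108 - ε ^ 2 / 54) := mul_nonneg hε0 (by nlinarith)
    linarith
  have h5 := mul_le_mul_of_nonneg_right h3 hM
  exact le_of_mul_le_mul_left (a := (1 - 2 / 3 * ε / 3) * (1 - 1 / 2 * ε / 3)) (by linarith)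
    (mul_pos hα hβ)

/-- The lattice point next to the centroid of `C` has mixed-integer
depth at least `1 / (2e)`. -/
theorem exists_deep_point (hconv : Convex ℝ C) (hcomp : IsCompact C)
    (hint : (interior C).Nonempty) (hk : 3 * Real.exp 1 * ((n : ℝ) + (d : ℝ)) ≤ k)
    (hk12 : 12 ≤ k) (hcube : ∀ u : Fin n → ℝ, ‖u‖ ≤ 1 → ∃ r ∈ C, r.1 = z₀ + k • u) :
    ∃ y ∈ points C, ∀ H : Set (Space n d), IsClosedHalfspace H → y ∈ H →
      ENNReal.ofReal (1 / (2 * Real.exp 1)) * mixedVolume C ≤ mixedVolume (C ∩ H) := by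
  have hCm := hcomp.measurableSet
  have hne : C.Nonempty := hint.mono interior_subset
  have hvol0 : volume C ≠ 0 := (Measure.measure_pos_of_nonempty_interior _ hint).ne'
  have hvolfin : volume C ≠ ∞ := hcomp.measure_lt_top.ne
  have he : 2 ≤ Real.exp 1 := by linarith [Real.add_one_le_exp (1 : ℝ)]
  have hk0 : 0 < k := by linarith
  have hk2 : 1 / 2 < k := by linarith
  set ε : ℝ := 1 / Real.exp 1 with hε
  have hε0 : 0 < ε := by positivity
  have hε2 : ε ≤ 1 / 2 := by rw [hε]; gcongr
  have hNk : ((n + d : ℕ) : ℝ) / k ≤ ε / 3 := by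
    rw [div_le_div_iff₀ hk0 (by norm_num), hε, div_mul_eq_mul_div, le_div_iff₀ (by linarith)]
    push_cast
    linarith
  have hinv : 1 / (2 * k) < 1 := one_div_two_mul_lt_one hk2
  have hpow0 : ∀ t : ℝ, t ≤ 1 → 0 ≤ (1 - t) ^ (n + d) := fun t ht => pow_nonneg (by linarith) _
  have hfin := mixedVolume_ne_top hconv hcomp hk2 hcube
  have hmfin : ∀ A : Set (Space n d), MeasurableSet A → mixedVolume (C ∩ A) ≠ ∞ := by
    intro A hA
    rw [← mixedMeasure_apply (hCm.inter hA)]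
    refine ((measure_mono Set.inter_subset_left).trans_lt ?_).ne
    rw [mixedMeasure_apply hCm]
    exact hfin.lt_top
  have hvfin : ∀ A : Set (Space n d), volume (C ∩ A) ≠ ∞ := fun A =>
    ((measure_mono Set.inter_subset_left).trans_lt hcomp.measure_lt_top).ne
  set X := volume.real C with hX
  set M := (mixedVolume C).toReal with hM
  have hX0 : 0 ≤ X := measureReal_nonneg
  have hM0 : 0 ≤ M := ENNReal.toReal_nonneg
  have hpow := one_sub_le_pow (N := n + d) (t := 1 / (2 * k)) (q := 1 / 2) hinv.le (by norm_num)
    (le_of_eq (by field_simp)) hNk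
  have hXM : (1 - 1 / 2 * ε / 3) * X ≤ M := by
    have h1 := ENNReal.toReal_mono hfin (mul_volume_le_mixedVolume hconv hcomp hk2 hcube)
    rw [ENNReal.toReal_mul, ENNReal.toReal_ofReal (hpow0 _ hinv.le)] at h1
    exact (mul_le_mul_of_nonneg_right hpow hX0).trans h1
  have hMX : (1 - 1 / 2 * ε / 3) * M ≤ X := by
    have h1 := ENNReal.toReal_mono hvolfin (mul_mixedVolume_le_volume hconv hcomp hk2 hcube)
    rw [ENNReal.toReal_mul, ENNReal.toReal_ofReal (hpow0 _ hinv.le)] at h1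
    exact (mul_le_mul_of_nonneg_right hpow hM0).trans h1
  set g : Space n d := ⨍ x in C, x with hg
  have hgC : g ∈ C := hconv.set_average_mem hcomp.isClosed hvol0 hvolfin
    (ae_restrict_mem hCm) (continuous_id.continuousOn.integrableOn_compact hcomp)
  obtain ⟨p, hp, hy⟩ := exists_convexComb_mem_points hconv hk2 hcube hgC
  refine ⟨_, hy, fun H hH hyH => ?_⟩
  obtain ⟨a, c, ha, rfl⟩ := isClosedHalfspace_iff.1 hH
  set φ := pairing a with hφ
  have hc : c ≤ (1 - 1 / (2 * k)) * φ g + 1 / (2 * k) * φ p := by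
    have : c ≤ φ ((1 - 1 / (2 * k)) • g + (1 / (2 * k)) • p) := hyH
    simpa only [map_add, map_smul, smul_eq_mul] using this
  have hHm : MeasurableSet {v | c ≤ φ v} := measurableSet_le measurable_const φ.measurable
  have hGm : MeasurableSet {v | φ v < c} := measurableSet_lt φ.measurable measurable_const
  suffices h : ε / 2 * M ≤ (mixedVolume (C ∩ {v | c ≤ φ v})).toReal by
    rw [← ENNReal.toReal_le_toReal (ENNReal.mul_ne_top ENNReal.ofReal_ne_top hfin) (hmfin _ hHm),
      ENNReal.toReal_mul, ENNReal.toReal_ofReal (by positivity)]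
    refine le_trans (le_of_eq ?_) h
    rw [hε, ← hM]
    field_simp
  have hgr := fun {t b : ℝ} (ht0 : 0 ≤ t) (ht1 : t ≤ 1) =>
    measure_inter_halfspace_ge (μ := volume) (prekopaLeindler_space n d) hconv hcomp hvol0 φ hp
      (t := t) (c := b) ht0 ht1
  rw [show Module.finrank ℝ (Space n d) = n + d by simp] at hgr
  -- The weight `1 / 4` balances the losses in the two cases. The threshold is the convex
  -- combination of `φ g` and `φ p` for which the high case needs no loss in Grünbaum's inequality.
  rcases exists_high_or_low_section hcomp hne hcube φ (3 / 4 * φ g + 1 / 4 * φ p) (s := 1 / 4)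
    (by norm_num) with ⟨top, htop, hsec⟩ | ⟨bot, hbot, hsec⟩
  · have hl : 2 / k ≤ 1 / 6 := by
      rw [div_le_iff₀ hk0]
      linarith
    have hround := volume_halfspace_le_mixedVolume (l := 2 / k) (γ := φ g) (c := c) hconv hcomp φ
      (by norm_num) (by norm_num) (by positivity) (by linarith)
      (le_of_eq (by field_simp; norm_num)) htop hsec (hc.trans (le_of_eq (by field_simp; ring)))
    have h1 := ENNReal.toReal_mono (hmfin _ hHm) hround
    rw [ENNReal.toReal_mul, ENNReal.toReal_ofReal (hpow0 _ (by linarith))] at h1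
    have h2 := hgr (t := 0) (b := φ g) le_rfl zero_le_one (by simp [hg])
    rw [sub_zero, one_pow, ← hε] at h2
    have h3 := one_sub_le_pow (N := n + d) (t := 2 / k) (by linarith) (by norm_num) le_rfl hNk
    calc ε / 2 * M ≤ (1 - 2 * ε / 3) * (ε * X) :=
          half_mul_le_of_high_section hε0.le hε2 hM0 hMX
      _ ≤ (1 - 2 / k) ^ (n + d) * volume.real (C ∩ {v | φ g ≤ φ v}) :=
          mul_le_mul h3 h2 (by positivity) (hpow0 _ (by linarith))
      _ ≤ _ := h1
  · have hl : 2 / (3 * k) ≤ 1 / 18 := by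
      rw [div_le_iff₀ (by positivity)]
      linarith
    have hl0 : 0 < 2 / (3 * k) := by positivity
    -- The open halfspace `{φ < b}` has on its boundary `(1 - τ) • g + τ • p`, a point that is
    -- still close to the centroid.
    set τ : ℝ := 1 / (2 * k) + 2 / (3 * k) * (1 / 4) - 1 / (2 * k) * (2 / (3 * k)) with hτ
    set b : ℝ := (1 - τ) * φ g + τ * φ p with hb
    have hround := mixedVolume_open_halfspace_le_volume (l := 2 / (3 * k)) (c := c) (b := b)
      hconv hcomp φ (by norm_num) (by norm_num) hl0.le (by linarith)
      (le_of_eq (by field_simp; norm_num)) hbot hsec (by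
        have := mul_le_mul_of_nonneg_left hc (show 0 ≤ 1 - 2 / (3 * k) by linarith)
        refine (add_le_add_left this _).trans (le_of_eq ?_)
        rw [hb, hτ]
        ring)
    have h1 := ENNReal.toReal_mono (hvfin _) hround
    rw [ENNReal.toReal_mul, ENNReal.toReal_ofReal (hpow0 _ (by linarith))] at h1
    set D := (mixedVolume (C ∩ {v | φ v < c})).toReal with hD
    have hD0 : 0 ≤ D := ENNReal.toReal_nonneg
    have hτle : τ ≤ 2 / 3 / k := by
      have h2 : 1 / (2 * k) + 2 / (3 * k) * (1 / 4) = 2 / 3 / k := by field_simp; norm_num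
      have h3 : 0 < 1 / (2 * k) * (2 / (3 * k)) := by positivity
      linarith
    have hτ0 : 0 ≤ τ := by
      have : 1 / (2 * k) * (2 / (3 * k)) ≤ 1 / (2 * k) * 1 := by
        gcongr
        linarith
      linarith
    have hτ1 : τ ≤ 1 := by
      have : 2 / 3 / k = 2 / (3 * k) := by field_simp
      linarith
    have h2 := hgr (t := τ) (b := b) hτ0 hτ1 le_rfl
    have h3 := one_sub_le_pow (N := n + d) (t := τ) hτ1 (by norm_num) hτle hNk
    have h4 := one_sub_le_pow (N := n + d) (t := 2 / (3 * k)) (q := 2 / 3) (by linarith)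
      (by norm_num) (le_of_eq (by field_simp)) hNk
    have h5 : volume.real (C ∩ {v | φ v < b}) = X - volume.real (C ∩ {v | b ≤ φ v}) := by
      have := measureReal_inter_add_sdiff (μ := volume) (s := C)
        (measurableSet_lt φ.measurable (measurable_const (a := b))) hvolfin
      have hset : C \ {v | φ v < b} = C ∩ {v | b ≤ φ v} := by
        ext v
        simp
      rw [hset] at this
      linarith
    have h6 : D + (mixedVolume (C ∩ {v | c ≤ φ v})).toReal = M := by
      have hset : C \ {v | φ v < c} = C ∩ {v | c ≤ φ v} := by
        ext v
        simp
      rw [hD, hM, ← ENNReal.toReal_add (hmfin _ hGm) (hmfin _ hHm),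
        ← mixedMeasure_apply (hCm.inter hGm), ← mixedMeasure_apply (hCm.inter hHm),
        ← mixedMeasure_apply hCm, ← hset, measure_inter_add_sdiff C hGm]
    have h7 : (1 - 2 / 3 * ε / 3) * ε * X ≤ volume.real (C ∩ {v | b ≤ φ v}) := by
      refine le_trans ?_ h2
      rw [div_eq_mul_one_div _ (Real.exp 1), ← hε]
      exact mul_le_mul_of_nonneg_right (mul_le_mul_of_nonneg_right h3 hε0.le) hX0
    have h8 : (1 - 2 / 3 * ε / 3) * D ≤ volume.real (C ∩ {v | φ v < b}) :=
      (mul_le_mul_of_nonneg_right h4 hD0).trans h1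
    have h9 := le_one_sub_half_mul_of_low_section hε0.le hε2 hM0 hXM (D := D) (by linarith)
    linarith

end DeepPoint

end MixedInteger

open MixedInteger in
theorem corollary1 (n d : ℕ) (hn : 0 < n) (hd : 0 < d)
    (C : Set (MixedInteger.Space n d))
    (hconv : Convex ℝ C) (hcomp : IsCompact C) (hint : (interior C).Nonempty)
    (z₀ : Fin n → ℝ) (k : ℝ)
    (hk : 3 * Real.exp 1 * ((n : ℝ) + (d : ℝ)) ≤ k)
    (hbox : (fun u : Fin n → ℝ => z₀ + k • u) '' Metric.closedBall (0 : Fin n → ℝ) 1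
      ⊆ Prod.fst '' C) :
    (MixedInteger.centerpoints (MixedInteger.points C)).Nonempty ∧
    (∀ y ∈ MixedInteger.centerpoints (MixedInteger.points C),
      ENNReal.ofReal (1 / (2 * Real.exp 1)) *
          MixedInteger.mixedVolume (MixedInteger.points C)
        ≤ MixedInteger.depth (MixedInteger.points C) y) ∧
    ENNReal.ofReal (1 / (2 ^ n * Real.exp 1)) *
        MixedInteger.mixedVolume (MixedInteger.points C)
      ≤ ENNReal.ofReal (1 / (2 * Real.exp 1)) *
        MixedInteger.mixedVolume (MixedInteger.points C) ∧
    (∃ y ∈ MixedInteger.points C, ∀ H : Set (MixedInteger.Space n d),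
      MixedInteger.IsClosedHalfspace H → y ∈ H →
        ENNReal.ofReal (1 / (2 ^ n * Real.exp 1)) *
            MixedInteger.mixedVolume (MixedInteger.points C)
          ≤ MixedInteger.mixedVolume (MixedInteger.points C ∩ H)) := by
  have hcube : ∀ u : Fin n → ℝ, ‖u‖ ≤ 1 → ∃ r ∈ C, r.1 = z₀ + k • u := fun u hu =>
    hbox (Set.mem_image_of_mem _ (mem_closedBall_zero_iff.2 hu))
  have hk12 : 12 ≤ k := by
    have he : 2 ≤ Real.exp 1 := by linarith [Real.add_one_le_exp (1 : ℝ)]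
    have hnd : (2 : ℝ) ≤ n + d := by exact_mod_cast (by omega : 2 ≤ n + d)
    nlinarith
  have hfin := mixedVolume_ne_top hconv hcomp (by linarith) hcube
  obtain ⟨y, hy, hdeep⟩ := exists_deep_point hconv hcomp hint hk hk12 hcube
  simp only [mixedVolume_points_inter]
  rw [mixedVolume_points]
  have hconst : ENNReal.ofReal (1 / (2 ^ n * Real.exp 1)) * mixedVolume C
      ≤ ENNReal.ofReal (1 / (2 * Real.exp 1)) * mixedVolume C := by
    gcongr
    exact le_self_pow₀ one_le_two hn.ne'
  refine ⟨centerpoints_points_nonempty hcomp hfin ⟨y, hy⟩, fun y' hy' => ?_, hconst,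
    y, hy, fun H hH hyH => hconst.trans (hdeep H hH hyH)⟩
  refine le_trans (le_sInf ?_) (hy'.2 y hy)
  rintro _ ⟨H, hH, hyH, rfl⟩
  rw [mixedVolume_points_inter]
  exact hdeep H hH hyH
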